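/- Let $N>4$ be an integer and let $\Omega\subset\mathbb R^N$ be a smooth bounded domain, i.e. a nonempty, bounded, connected open set which, near each point of $\partial\Omega$, has the form $\{\rho<0\}$ for a $C^\infty$ function $\rho$ with $\nabla\rho\neq0$ at that point. Let $H^1(\Omega)$ and $H^2(\Omega)$ be the Sobolev spaces of real-valued functions whose weak derivatives of order at most $1$, respectively at most $2$, lie in $L^2(\Omega)$, and let $H^1_0(\Omega)$ be the closure of $C_c^\infty(\Omega)$ in $H^1(\Omega)$. Then for every $u\in H^2(\Omega)\cap H^1_0(\Omega)$ one has $\frac{u}{|x|^2}\in L^2(\Omega)$, $\frac{\nabla u}{|x|}\in L^2(\Omega;\mathbb R^N)$ and $$(N-4)^2\int_\Omega\frac{|u|^2}{|x|^4}\,dx+2(N-4)\int_\Omega\frac{|\nabla u|^2}{|x|^2}\,dx\le\int_\Omega|\Delta u|^2\,dx,$$ where $\nabla u$ and $\Delta u$ are the weak gradient and the weak Laplacian of $u$. (The origin may lie inside $\Omega$, on its boundary, or outside.) -/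

import Mathlib

open MeasureTheory Set Filter Topology
open scoped ContDiff ENNReal

noncomputable section

/-- The Euclidean space `ℝᴺ`. -/
abbrev RSpace (N : ℕ) : Type := EuclideanSpace ℝ (Fin N)

/-- A bounded domain (nonempty, open, connected) of `ℝᴺ` with `C^∞` boundary: near each boundary
point it is the sublevel set `{ρ < 0}` of a smooth function with nonvanishing differential. -/
structure IsSmoothBoundedDomain {N : ℕ} (Ω : Set (RSpace N)) : Prop where
  isOpen : IsOpen Ω
  isConnected : IsConnected Ω
  isBounded : Bornology.IsBounded Ω
  smooth_boundary : ∀ x₀ ∈ frontier Ω, ∃ (U : Set (RSpace N)) (ρ : RSpace N → ℝ),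
    IsOpen U ∧ x₀ ∈ U ∧ ContDiffOn ℝ ∞ ρ U ∧ fderiv ℝ ρ x₀ ≠ 0 ∧
      Ω ∩ U = {x ∈ U | ρ x < 0}

/-- The space `C_c^∞(Ω)` of test functions. -/
def IsTestFunction {N : ℕ} (Ω : Set (RSpace N)) (φ : RSpace N → ℝ) : Prop :=
  ContDiff ℝ ∞ φ ∧ HasCompactSupport φ ∧ tsupport φ ⊆ Ω

/-- The classical partial derivative `∂φ/∂xᵢ`. -/
def partialDeriv {N : ℕ} (i : Fin N) (φ : RSpace N → ℝ) (x : RSpace N) : ℝ :=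
  fderiv ℝ φ x (EuclideanSpace.single i 1)

/-- `v` is a weak partial derivative of `u` in the direction `xᵢ` on `Ω`. -/
def HasWeakPartial {N : ℕ} (Ω : Set (RSpace N)) (i : Fin N) (u v : RSpace N → ℝ) : Prop :=
  LocallyIntegrableOn u Ω ∧ LocallyIntegrableOn v Ω ∧
    ∀ φ : RSpace N → ℝ, IsTestFunction Ω φ →
      ∫ x in Ω, u x * partialDeriv i φ x = -∫ x in Ω, v x * φ x

open Classical in
/-- The weak partial derivative of `u` in the direction `xᵢ` on `Ω`: a representative of it if it
exists (it is unique a.e. on `Ω`), and `0` otherwise. -/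
def weakPartial {N : ℕ} (Ω : Set (RSpace N)) (i : Fin N) (u : RSpace N → ℝ) : RSpace N → ℝ :=
  if h : ∃ v, HasWeakPartial Ω i u v then h.choose else 0

/-- The weak gradient `∇u` on `Ω`. -/
def weakGrad {N : ℕ} (Ω : Set (RSpace N)) (u : RSpace N → ℝ) (x : RSpace N) : RSpace N :=
  WithLp.toLp 2 fun i => weakPartial Ω i u x

/-- The weak Laplacian `Δu = ∑ᵢ ∂ᵢ∂ᵢu` on `Ω`. -/
def weakLaplacian {N : ℕ} (Ω : Set (RSpace N)) (u : RSpace N → ℝ) (x : RSpace N) : ℝ :=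
  ∑ i, weakPartial Ω i (weakPartial Ω i u) x

/-- `u ∈ H¹(Ω)`: `u` and its first order weak derivatives lie in `L²(Ω)`. -/
def MemH1 {N : ℕ} (Ω : Set (RSpace N)) (u : RSpace N → ℝ) : Prop :=
  MemLp u 2 (volume.restrict Ω) ∧
    ∀ i, ∃ v, HasWeakPartial Ω i u v ∧ MemLp v 2 (volume.restrict Ω)

/-- `u ∈ H²(Ω)`: `u` and its weak derivatives of order one and two lie in `L²(Ω)`. -/
def MemH2 {N : ℕ} (Ω : Set (RSpace N)) (u : RSpace N → ℝ) : Prop :=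
  MemH1 Ω u ∧ ∀ i, MemH1 Ω (weakPartial Ω i u)

/-- `u ∈ H¹₀(Ω)`: `u` lies in the closure of `C_c^∞(Ω)` in `H¹(Ω)`. -/
def MemH10 {N : ℕ} (Ω : Set (RSpace N)) (u : RSpace N → ℝ) : Prop :=
  MemH1 Ω u ∧ ∃ φ : ℕ → RSpace N → ℝ, (∀ n, IsTestFunction Ω (φ n)) ∧
    Tendsto (fun n => eLpNorm (fun x => u x - φ n x) 2 (volume.restrict Ω)) atTop (𝓝 0) ∧
    ∀ i, Tendsto (fun n => eLpNorm (fun x => weakPartial Ω i u x - partialDeriv i (φ n) x) 2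
      (volume.restrict Ω)) atTop (𝓝 0)

theorem HasWeakPartial.weakPartial_spec {N : ℕ} {Ω : Set (RSpace N)} {i : Fin N}
    {u v : RSpace N → ℝ} (h : HasWeakPartial Ω i u v) :
    HasWeakPartial Ω i u (weakPartial Ω i u) := by
  have hex : ∃ v, HasWeakPartial Ω i u v := ⟨v, h⟩
  rw [weakPartial, dif_pos hex]
  exact hex.choose_spec

theorem HasWeakPartial.ae_unique {N : ℕ} {Ω : Set (RSpace N)} (hΩ : IsOpen Ω) {i : Fin N}
    {u v w : RSpace N → ℝ} (hv : HasWeakPartial Ω i u v) (hw : HasWeakPartial Ω i u w) :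
    v =ᵐ[volume.restrict Ω] w := by
  have key : ∀ᵐ x ∂volume, x ∈ Ω → (v - w) x = 0 := by
    refine hΩ.ae_eq_zero_of_integral_contDiff_smul_eq_zero (hv.2.1.sub hw.2.1) ?_
    intro g hg hgc hgs
    have hint : ∀ f : RSpace N → ℝ, LocallyIntegrableOn f Ω →
        Integrable (fun x => f x * g x) (volume.restrict Ω) := by
      intro f hf
      have h1 : IntegrableOn f (tsupport g) := hf.integrableOn_compact_subset hgs hgc
      have h2 : IntegrableOn (fun x => f x * g x) (tsupport g) :=
        h1.mul_continuousOn hg.continuous.continuousOn hgc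
      have h3 : Integrable (fun x => f x * g x) volume := by
        rw [← integrableOn_iff_integrable_of_support_subset]
        · exact h2
        · intro x hx
          exact subset_tsupport g (fun h0 => hx (by simp [h0]))
      exact h3.integrableOn
    have e1 := hv.2.2 g ⟨hg, hgc, hgs⟩
    have e2 := hw.2.2 g ⟨hg, hgc, hgs⟩
    have e3 : ∫ x in Ω, (v x * g x - w x * g x) = 0 := by
      rw [integral_sub (hint v hv.2.1) (hint w hw.2.1)]
      linarith
    rw [← e3, ← setIntegral_eq_integral_of_forall_compl_eq_zero (s := Ω)]
    · congr 1
      ext x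
      simp only [Pi.sub_apply, smul_eq_mul]
      ring
    · intro x hx
      have : g x = 0 := by
        by_contra h0
        exact hx (hgs (subset_tsupport g h0))
      simp [this]
  rw [Filter.EventuallyEq, ae_restrict_iff' hΩ.measurableSet]
  filter_upwards [key] with x hx hxΩ
  exact sub_eq_zero.mp (hx hxΩ)

end

/-! Put `w = (|x|² + ε)⁻¹` and expand `0 ≤ ∫ (Δu + (N-4) u w)²`. Two integrations by parts give `∫
Δu · u w = -∫ |∇u|² w + ½ ∫ u² Δw`, and `Δw ≤ -2(N-4) w²`. Together these yield `(N-4)² ∫ u² w² +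
2(N-4) ∫ |∇u|² w ≤ ∫ |Δu|²` (`regularized_rellich`), with a right-hand side free of `ε`. Fatou's
lemma as `ε → 0` then gives both integrability claims and the inequality.

Since `w` is smooth everywhere, the origin needs no special care before the limit. No boundary terms
arise because each integration by parts pairs an `H¹` function with `u` times a smooth function, and
only `u` has to be approximated by test functions (`MemH10.integral_mul_weakPartial`). -/

/-! ### Integration by parts against `H¹₀` functions -/

/-- A continuous function is a multiplier of `L²` on a bounded set. -/
theorem MeasureTheory.MemLp.mul_continuous_of_isBounded {N : ℕ} {Ω : Set (RSpace N)}
    (hΩ : IsOpen Ω) (hb : Bornology.IsBounded Ω) {p w : RSpace N → ℝ}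
    (hp : MemLp p 2 (volume.restrict Ω)) (hw : Continuous w) :
    MemLp (fun x => p x * w x) 2 (volume.restrict Ω) := by
  obtain ⟨C, hC⟩ := (hb.isCompact_closure).exists_bound_of_continuousOn hw.continuousOn
  refine MemLp.of_le_mul (c := C) hp (hp.1.mul hw.aestronglyMeasurable) ?_
  filter_upwards [ae_restrict_mem hΩ.measurableSet] with x hx
  rw [norm_mul, mul_comm]
  exact mul_le_mul_of_nonneg_right (hC x (subset_closure hx)) (norm_nonneg _)

/-- Pairing with a fixed `L²` function is continuous along `L²` convergence. -/
theorem tendsto_integral_mul_of_eLpNorm_two {α : Type*} [MeasurableSpace α] {μ : Measure α}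
    {p f : α → ℝ} {F : ℕ → α → ℝ} (hp : MemLp p 2 μ) (hf : MemLp f 2 μ)
    (hF : ∀ n, MemLp (F n) 2 μ)
    (h : Tendsto (fun n => eLpNorm (fun x => f x - F n x) 2 μ) atTop (𝓝 0)) :
    Tendsto (fun n => ∫ x, p x * F n x ∂μ) atTop (𝓝 (∫ x, p x * f x ∂μ)) := by
  refine tendsto_integral_of_L1' (fun x => p x * f x) (hp.integrable_mul hf).1
    (Eventually.of_forall fun n => hp.integrable_mul (hF n)) ?_
  have hlim : Tendsto (fun n => eLpNorm p 2 μ * eLpNorm (fun x => f x - F n x) 2 μ) atTop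
      (𝓝 0) := by
    simpa using ENNReal.Tendsto.const_mul h (Or.inr hp.2.ne)
  refine tendsto_of_tendsto_of_tendsto_of_le_of_le tendsto_const_nhds hlim
    (fun _ => zero_le) fun n => ?_
  have hle := eLpNorm_smul_le_mul_eLpNorm (p := 2) (q := 2) (r := 1)
    (hf.sub (hF n)).1 hp.1
  refine le_trans (le_of_eq ?_) hle
  rw [← eLpNorm_neg]
  congr 1
  ext x
  simp only [Pi.neg_apply, Pi.sub_apply, Pi.smul_apply', smul_eq_mul]
  ring

theorem partialDeriv_mul {N : ℕ} (i : Fin N) {φ w : RSpace N → ℝ}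
    (hφ : Differentiable ℝ φ) (hw : Differentiable ℝ w) (x : RSpace N) :
    partialDeriv i (fun y => φ y * w y) x
      = w x * partialDeriv i φ x + φ x * partialDeriv i w x := by
  unfold partialDeriv
  rw [fderiv_fun_mul (hφ x) (hw x)]
  simp only [add_apply, smul_apply, smul_eq_mul]
  ring

theorem ContDiff.partialDeriv {N : ℕ} (i : Fin N) {φ : RSpace N → ℝ} (hφ : ContDiff ℝ ∞ φ) :
    ContDiff ℝ ∞ (partialDeriv i φ) :=
  (hφ.fderiv_right (m := ∞) (by simp)).clm_apply contDiff_const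

theorem IsTestFunction.mul {N : ℕ} {Ω : Set (RSpace N)} {φ w : RSpace N → ℝ}
    (hφ : IsTestFunction Ω φ) (hw : ContDiff ℝ ∞ w) : IsTestFunction Ω (fun x => φ x * w x) :=
  ⟨hφ.1.mul hw, hφ.2.1.mul_right, (tsupport_mul_subset_left (f := φ) (g := w)).trans hφ.2.2⟩

theorem IsTestFunction.memLp {N : ℕ} {Ω : Set (RSpace N)} {φ : RSpace N → ℝ}
    (hφ : IsTestFunction Ω φ) : MemLp φ 2 (volume.restrict Ω) :=
  (hφ.1.continuous.memLp_of_hasCompactSupport hφ.2.1).restrict Ω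

theorem IsTestFunction.memLp_partialDeriv {N : ℕ} {Ω : Set (RSpace N)} {φ : RSpace N → ℝ}
    (hφ : IsTestFunction Ω φ) (i : Fin N) :
    MemLp (partialDeriv i φ) 2 (volume.restrict Ω) :=
  ((hφ.1.partialDeriv i).continuous.memLp_of_hasCompactSupport
    (hφ.2.1.fderiv_apply ℝ (EuclideanSpace.single i 1))).restrict Ω

theorem MemH1.hasWeakPartial {N : ℕ} {Ω : Set (RSpace N)} {u : RSpace N → ℝ}
    (hu : MemH1 Ω u) (i : Fin N) : HasWeakPartial Ω i u (weakPartial Ω i u) :=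
  (hu.2 i).choose_spec.1.weakPartial_spec

/-- `weakPartial` picks an arbitrary weak derivative, not necessarily the one known to be in `L²`;
almost everywhere uniqueness transfers the bound. -/
theorem MemH1.memLp_weakPartial {N : ℕ} {Ω : Set (RSpace N)} (hΩ : IsOpen Ω)
    {u : RSpace N → ℝ} (hu : MemH1 Ω u) (i : Fin N) :
    MemLp (weakPartial Ω i u) 2 (volume.restrict Ω) := by
  obtain ⟨v, hv, hv2⟩ := hu.2 i
  exact hv2.ae_eq (hv.ae_unique hΩ hv.weakPartial_spec)

/-- Integration by parts of `p ∈ H¹(Ω)` against `u w` with `u ∈ H¹₀(Ω)` and `w` smooth. -/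
theorem MemH10.integral_mul_weakPartial {N : ℕ} {Ω : Set (RSpace N)} (hΩ : IsOpen Ω)
    (hb : Bornology.IsBounded Ω) {u p w : RSpace N → ℝ} (hu : MemH10 Ω u) (hp : MemH1 Ω p)
    (hw : ContDiff ℝ ∞ w) (i : Fin N) :
    (∫ x in Ω, p x * w x * weakPartial Ω i u x) + ∫ x in Ω, p x * partialDeriv i w x * u x
      = -∫ x in Ω, weakPartial Ω i p x * w x * u x := by
  obtain ⟨hu1, φ, hφ, t0, t1⟩ := hu
  have hpw := hp.1.mul_continuous_of_isBounded hΩ hb hw.continuous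
  have hpw' := hp.1.mul_continuous_of_isBounded hΩ hb (hw.partialDeriv i).continuous
  have hqw := (hp.memLp_weakPartial hΩ i).mul_continuous_of_isBounded hΩ hb hw.continuous
  have l1 := tendsto_integral_mul_of_eLpNorm_two hpw (hu1.memLp_weakPartial hΩ i)
    (fun n => (hφ n).memLp_partialDeriv i) (t1 i)
  have l2 := tendsto_integral_mul_of_eLpNorm_two hpw' hu1.1 (fun n => (hφ n).memLp) t0
  have l3 := tendsto_integral_mul_of_eLpNorm_two hqw hu1.1 (fun n => (hφ n).memLp) t0
  refine tendsto_nhds_unique ((l1.add l2).congr fun n => ?_) l3.neg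
  have hadd := integral_add (hpw.integrable_mul ((hφ n).memLp_partialDeriv i))
    (hpw'.integrable_mul (hφ n).memLp)
  refine hadd.symm.trans ?_
  -- `φ n * w` is itself a test function, so the definition of the weak derivative of `p` applies to
  -- it.
  have e := (hp.hasWeakPartial i).2.2 _ ((hφ n).mul hw)
  calc _ = ∫ x in Ω, p x * partialDeriv i (fun y => φ n y * w y) x := by
        congr 1
        ext x
        simp only [Pi.mul_apply]
        rw [partialDeriv_mul i ((hφ n).1.differentiable (by simp)) (hw.differentiable (by simp))]
        ring
    _ = _ := by
        rw [e]
        congr 2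
        ext x
        ring

/-! ### The regularised weight and its Laplacian -/

section Weight

variable {N : ℕ} {ε : ℝ}

theorem norm_sq_add_pos (hε : 0 < ε) (x : RSpace N) : 0 < ‖x‖ ^ 2 + ε := by positivity

theorem contDiff_inv_norm_sq_add (hε : 0 < ε) :
    ContDiff ℝ ∞ (fun x : RSpace N => (‖x‖ ^ 2 + ε)⁻¹) :=
  ((contDiff_norm_sq ℝ).add contDiff_const).inv fun x => (norm_sq_add_pos hε x).ne'

theorem partialDeriv_inv_norm_sq_add (hε : 0 < ε) (i : Fin N) :
    partialDeriv i (fun x : RSpace N => (‖x‖ ^ 2 + ε)⁻¹)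
      = fun x => -2 * x i / (‖x‖ ^ 2 + ε) ^ 2 := by
  ext x
  have h1 : HasFDerivAt (fun x : RSpace N => ‖x‖ ^ 2 + ε) (2 • innerSL ℝ x) x :=
    (hasStrictFDerivAt_norm_sq x).hasFDerivAt.add_const ε
  have h2 := (hasDerivAt_inv (norm_sq_add_pos hε x).ne').comp_hasFDerivAt x h1
  have h3 : HasFDerivAt (fun x : RSpace N => (‖x‖ ^ 2 + ε)⁻¹) _ x := h2
  rw [partialDeriv, h3.fderiv]
  simp [EuclideanSpace.inner_single_right, div_eq_mul_inv]
  ring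

theorem partialDeriv_partialDeriv_inv_norm_sq_add (hε : 0 < ε) (i : Fin N) (x : RSpace N) :
    partialDeriv i (partialDeriv i (fun x : RSpace N => (‖x‖ ^ 2 + ε)⁻¹)) x
      = -2 * (‖x‖ ^ 2 + ε)⁻¹ ^ 2 + 8 * x i ^ 2 * (‖x‖ ^ 2 + ε)⁻¹ ^ 3 := by
  have hw := contDiff_inv_norm_sq_add (N := N) hε
  have hd := hw.differentiable (by simp)
  have e : partialDeriv i (fun x : RSpace N => (‖x‖ ^ 2 + ε)⁻¹)
      = fun x => (-2 * x i) * ((‖x‖ ^ 2 + ε)⁻¹ * (‖x‖ ^ 2 + ε)⁻¹) := by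
    rw [partialDeriv_inv_norm_sq_add hε]
    ext x
    rw [div_eq_mul_inv, ← inv_pow]
    ring
  have hc : HasFDerivAt (fun x : RSpace N => -2 * x i)
      ((-2 : ℝ) • (EuclideanSpace.proj i : RSpace N →L[ℝ] ℝ)) x :=
    ((EuclideanSpace.proj i : RSpace N →L[ℝ] ℝ).hasFDerivAt).const_mul (-2)
  have hcd : Differentiable ℝ (fun x : RSpace N => -2 * x i) :=
    ((EuclideanSpace.proj i : RSpace N →L[ℝ] ℝ).differentiable).const_mul (-2)
  have hci : partialDeriv i (fun x : RSpace N => -2 * x i) x = -2 := by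
    rw [partialDeriv, hc.fderiv]
    simp
  rw [e, partialDeriv_mul i hcd (hd.fun_mul hd), hci, partialDeriv_mul i hd hd, e]
  ring

/-- The regularised weight satisfies `Δw ≤ -2(N-4) w²`. -/
theorem laplacian_inv_norm_sq_add_le (hε : 0 < ε) (x : RSpace N) :
    ∑ i, partialDeriv i (partialDeriv i (fun x : RSpace N => (‖x‖ ^ 2 + ε)⁻¹)) x
      ≤ -2 * ((N : ℝ) - 4) * (‖x‖ ^ 2 + ε)⁻¹ ^ 2 := by
  simp_rw [partialDeriv_partialDeriv_inv_norm_sq_add hε]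
  have hs : ∑ i, x i ^ 2 = ‖x‖ ^ 2 := by rw [EuclideanSpace.real_norm_sq_eq]
  rw [Finset.sum_add_distrib, ← Finset.sum_mul, ← Finset.sum_mul, ← Finset.mul_sum, hs]
  simp only [Finset.sum_const, Finset.card_univ, Fintype.card_fin, nsmul_eq_mul]
  have hp := norm_sq_add_pos hε x
  -- This turns `Δw = -2N w² + 8|x|² w³` into the bound `(-2N + 8) w²`.
  have h1 : ‖x‖ ^ 2 * (‖x‖ ^ 2 + ε)⁻¹ ≤ 1 := by
    rw [← div_eq_mul_inv, div_le_one hp]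
    linarith
  nlinarith [mul_le_mul_of_nonneg_right h1 (sq_nonneg (‖x‖ ^ 2 + ε)⁻¹)]

end Weight

/-! ### The regularised inequality -/

theorem norm_weakGrad_sq {N : ℕ} (Ω : Set (RSpace N)) (u : RSpace N → ℝ) (x : RSpace N) :
    ‖weakGrad Ω u x‖ ^ 2 = ∑ i, weakPartial Ω i u x ^ 2 := by
  rw [EuclideanSpace.real_norm_sq_eq]
  rfl

theorem MemH1.memLp_weakGrad {N : ℕ} {Ω : Set (RSpace N)} (hΩ : IsOpen Ω)
    {u : RSpace N → ℝ} (hu : MemH1 Ω u) : MemLp (weakGrad Ω u) 2 (volume.restrict Ω) := by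
  have hm : AEStronglyMeasurable (weakGrad Ω u) (volume.restrict Ω) :=
    (PiLp.continuous_toLp 2 (fun _ : Fin N => ℝ)).comp_aestronglyMeasurable
      (aemeasurable_pi_lambda _ fun i =>
        (hu.memLp_weakPartial hΩ i).1.aemeasurable).aestronglyMeasurable
  rw [memLp_two_iff_integrable_sq_norm hm]
  simp_rw [norm_weakGrad_sq]
  exact integrable_finsetSum _ fun i _ => (hu.memLp_weakPartial hΩ i).integrable_sq

/-- The inequality with the weight `|x|⁻²` replaced by `(|x|² + ε)⁻¹`. -/
theorem regularized_rellich {N : ℕ} (hN : 4 < N) {Ω : Set (RSpace N)} (hΩ : IsOpen Ω)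
    (hb : Bornology.IsBounded Ω) {u : RSpace N → ℝ} (hu2 : MemH2 Ω u) (hu0 : MemH10 Ω u)
    {ε : ℝ} (hε : 0 < ε) :
    Integrable (fun x => ((N : ℝ) - 4) ^ 2 * (u x * (‖x‖ ^ 2 + ε)⁻¹) ^ 2
      + 2 * ((N : ℝ) - 4) * (‖weakGrad Ω u x‖ ^ 2 * (‖x‖ ^ 2 + ε)⁻¹)) (volume.restrict Ω) ∧
    ∫ x in Ω, (((N : ℝ) - 4) ^ 2 * (u x * (‖x‖ ^ 2 + ε)⁻¹) ^ 2
      + 2 * ((N : ℝ) - 4) * (‖weakGrad Ω u x‖ ^ 2 * (‖x‖ ^ 2 + ε)⁻¹))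
      ≤ ∫ x in Ω, |weakLaplacian Ω u x| ^ 2 := by
  obtain ⟨hu1, hg1⟩ := hu2
  set w : RSpace N → ℝ := fun x => (‖x‖ ^ 2 + ε)⁻¹ with hwdef
  have hw : ContDiff ℝ ∞ w := contDiff_inv_norm_sq_add hε
  have hw' := fun i => hw.partialDeriv i
  have hw'' := fun i => (hw' i).partialDeriv i
  set g := fun i => weakPartial Ω i u with hgdef
  set q := fun i => weakPartial Ω i (g i) with hqdef
  have hg : ∀ i, MemLp (g i) 2 (volume.restrict Ω) := fun i => hu1.memLp_weakPartial hΩ i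
  have hq : ∀ i, MemLp (q i) 2 (volume.restrict Ω) := fun i => (hg1 i).memLp_weakPartial hΩ i
  have hu := hu1.1
  have hM : ∀ {p v : RSpace N → ℝ}, MemLp p 2 (volume.restrict Ω) → Continuous v →
      MemLp (fun x => p x * v x) 2 (volume.restrict Ω) :=
    fun hp hv => hp.mul_continuous_of_isBounded hΩ hb hv
  have hL : MemLp (weakLaplacian Ω u) 2 (volume.restrict Ω) :=
    memLp_finsetSum _ fun i _ => hq i
  have I1 : ∀ i, Integrable (fun x => g i x * w x * g i x) (volume.restrict Ω) :=
    fun i => (hM (hg i) hw.continuous).integrable_mul (hg i)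
  have I2 : ∀ i, Integrable (fun x => q i x * w x * u x) (volume.restrict Ω) :=
    fun i => (hM (hq i) hw.continuous).integrable_mul hu
  have I3 : ∀ i, Integrable (fun x => u x * partialDeriv i (partialDeriv i w) x * u x)
      (volume.restrict Ω) :=
    fun i => (hM hu (hw'' i).continuous).integrable_mul hu
  have huw := hM hu hw.continuous
  have IB : Integrable (fun x => (u x * w x) ^ 2) (volume.restrict Ω) := huw.integrable_sq
  have eA : (fun x => ‖weakGrad Ω u x‖ ^ 2 * w x) = fun x => ∑ i, g i x * w x * g i x := by
    ext x
    rw [norm_weakGrad_sq, Finset.sum_mul]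
    exact Finset.sum_congr rfl fun i _ => by ring
  have IA : Integrable (fun x => ‖weakGrad Ω u x‖ ^ 2 * w x) (volume.restrict Ω) := by
    rw [eA]
    exact integrable_finsetSum _ fun i _ => I1 i
  have ID : Integrable (fun x => weakLaplacian Ω u x ^ 2) (volume.restrict Ω) := hL.integrable_sq
  have IC : Integrable (fun x => weakLaplacian Ω u x * (u x * w x)) (volume.restrict Ω) :=
    hL.integrable_mul huw
  have hparts : ∀ i, (∫ x in Ω, q i x * w x * u x)
      = -(∫ x in Ω, g i x * w x * g i x)
        + 2⁻¹ * ∫ x in Ω, u x * partialDeriv i (partialDeriv i w) x * u x := by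
    intro i
    have e1 := hu0.integral_mul_weakPartial hΩ hb (hg1 i) hw i
    -- Here the cross term `∫ u ∂ᵢu ∂ᵢw` occurs on both sides, so it equals `-½ ∫ u² ∂ᵢ∂ᵢw`; this is
    -- the source of the factor `2⁻¹`.
    have e2 := hu0.integral_mul_weakPartial hΩ hb hu1 (hw' i) i
    have e3 : (∫ x in Ω, u x * partialDeriv i w x * weakPartial Ω i u x)
        = ∫ x in Ω, weakPartial Ω i u x * partialDeriv i w x * u x := by
      congr 1
      ext x
      ring
    simp only [hqdef, hgdef] at e1 e2 e3 ⊢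
    linarith
  have hC : (∫ x in Ω, weakLaplacian Ω u x * (u x * w x))
      = -(∫ x in Ω, ‖weakGrad Ω u x‖ ^ 2 * w x)
        + 2⁻¹ * ∫ x in Ω, ∑ i, u x * partialDeriv i (partialDeriv i w) x * u x := by
    have eC : (fun x => weakLaplacian Ω u x * (u x * w x))
        = fun x => ∑ i, q i x * w x * u x := by
      ext x
      rw [weakLaplacian, Finset.sum_mul]
      exact Finset.sum_congr rfl fun i _ => by simp only [hqdef, hgdef]; ring
    rw [eC, eA, integral_finsetSum _ fun i _ => I2 i, integral_finsetSum _ fun i _ => I1 i,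
      integral_finsetSum _ fun i _ => I3 i, Finset.mul_sum, ← Finset.sum_neg_distrib,
      ← Finset.sum_add_distrib]
    exact Finset.sum_congr rfl fun i _ => hparts i
  have hlap : (∫ x in Ω, ∑ i, u x * partialDeriv i (partialDeriv i w) x * u x)
      ≤ -2 * ((N : ℝ) - 4) * ∫ x in Ω, (u x * w x) ^ 2 := by
    rw [← integral_const_mul]
    refine integral_mono (integrable_finsetSum _ fun i _ => I3 i) (IB.const_mul _) fun x => ?_
    have h := mul_le_mul_of_nonneg_right (laplacian_inv_norm_sq_add_le hε x) (sq_nonneg (u x))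
    simp only
    calc _ = (∑ i, partialDeriv i (partialDeriv i w) x) * u x ^ 2 := by
          rw [Finset.sum_mul]
          exact Finset.sum_congr rfl fun i _ => by ring
      _ ≤ _ := h
      _ = _ := by simp only [hwdef]; ring
  have hsq : 0 ≤ ∫ x in Ω, (weakLaplacian Ω u x + ((N : ℝ) - 4) * (u x * w x)) ^ 2 :=
    integral_nonneg fun x => sq_nonneg _
  have hexp : (∫ x in Ω, (weakLaplacian Ω u x + ((N : ℝ) - 4) * (u x * w x)) ^ 2)
      = (∫ x in Ω, weakLaplacian Ω u x ^ 2)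
        + 2 * ((N : ℝ) - 4) * (∫ x in Ω, weakLaplacian Ω u x * (u x * w x))
        + ((N : ℝ) - 4) ^ 2 * ∫ x in Ω, (u x * w x) ^ 2 := by
    rw [← integral_const_mul, ← integral_const_mul, ← integral_add ID (IC.const_mul _)]
    refine Eq.trans ?_ (integral_add (ID.add (IC.const_mul _)) (IB.const_mul _))
    congr 1
    ext x
    ring
  refine ⟨(IB.const_mul _).add (IA.const_mul _), ?_⟩
  rw [integral_add (IB.const_mul _) (IA.const_mul _), integral_const_mul, integral_const_mul]
  simp only [sq_abs]
  have hN' : (0 : ℝ) < (N : ℝ) - 4 := by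
    have : (4 : ℝ) < N := by exact_mod_cast hN
    linarith
  rw [hexp, hC] at hsq
  nlinarith [mul_le_mul_of_nonneg_left hlap hN'.le]

/-! ### Passage to the limit -/

/-- A nonnegative almost everywhere limit of nonnegative functions with bounded integrals is
integrable, with the same bound. -/
theorem integrable_of_tendsto_of_integral_le {α : Type*} [MeasurableSpace α] {μ : Measure α}
    {f : α → ℝ} {F : ℕ → α → ℝ} {D : ℝ} (hF : ∀ n, Integrable (F n) μ)
    (hF0 : ∀ n x, 0 ≤ F n x) (hD : ∀ n, ∫ x, F n x ∂μ ≤ D)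
    (hlim : ∀ᵐ x ∂μ, Tendsto (fun n => F n x) atTop (𝓝 (f x))) :
    Integrable f μ ∧ ∫ x, f x ∂μ ≤ D := by
  have hD0 : 0 ≤ D := (integral_nonneg (hF0 0)).trans (hD 0)
  have hfm : AEStronglyMeasurable f μ :=
    aestronglyMeasurable_of_tendsto_ae atTop (fun n => (hF n).1) hlim
  have hf0 : 0 ≤ᵐ[μ] f := by
    filter_upwards [hlim] with x hx
    exact ge_of_tendsto' hx fun n => hF0 n x
  have hle : ∫⁻ x, ENNReal.ofReal (f x) ∂μ ≤ ENNReal.ofReal D := by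
    calc ∫⁻ x, ENNReal.ofReal (f x) ∂μ
        = ∫⁻ x, liminf (fun n => ENNReal.ofReal (F n x)) atTop ∂μ := by
          refine lintegral_congr_ae ?_
          filter_upwards [hlim] with x hx
          exact ((ENNReal.tendsto_ofReal hx).liminf_eq).symm
      _ ≤ liminf (fun n => ∫⁻ x, ENNReal.ofReal (F n x) ∂μ) atTop :=
          lintegral_liminf_le' fun n => (hF n).1.aemeasurable.ennreal_ofReal
      _ ≤ liminf (fun _ : ℕ => ENNReal.ofReal D) atTop := by
          refine liminf_le_liminf (Eventually.of_forall fun n => ?_)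
          rw [← ofReal_integral_eq_lintegral_ofReal (hF n) (Eventually.of_forall (hF0 n))]
          exact ENNReal.ofReal_le_ofReal (hD n)
      _ = ENNReal.ofReal D := by simp
  refine ⟨⟨hfm, ?_⟩, ?_⟩
  · rw [hasFiniteIntegral_iff_ofReal hf0]
    exact hle.trans_lt ENNReal.ofReal_lt_top
  · rw [integral_eq_lintegral_of_nonneg_ae hf0 hfm]
    exact ENNReal.toReal_le_of_le_ofReal hD0 hle

theorem mainTheorem7 (N : ℕ) (hN : 4 < N) (Ω : Set (RSpace N)) (hΩ : IsSmoothBoundedDomain Ω)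
    (u : RSpace N → ℝ) (hu2 : MemH2 Ω u) (hu0 : MemH10 Ω u) :
    MemLp (fun x => u x / ‖x‖ ^ 2) 2 (volume.restrict Ω) ∧
    MemLp (fun x => ‖x‖⁻¹ • weakGrad Ω u x) 2 (volume.restrict Ω) ∧
    ((N : ℝ) - 4) ^ 2 * (∫ x in Ω, |u x| ^ 2 / ‖x‖ ^ 4)
        + 2 * ((N : ℝ) - 4) * (∫ x in Ω, ‖weakGrad Ω u x‖ ^ 2 / ‖x‖ ^ 2)
      ≤ ∫ x in Ω, |weakLaplacian Ω u x| ^ 2 := by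
  have hN' : (0 : ℝ) < (N : ℝ) - 4 := by
    have : (4 : ℝ) < N := by exact_mod_cast hN
    linarith
  have hu1 := hu2.1
  have hgrad := hu1.memLp_weakGrad hΩ.isOpen
  have : Nonempty (Fin N) := ⟨⟨0, by omega⟩⟩
  -- At the origin the regularised weights blow up while `(‖0‖ ^ 2)⁻¹` is `0` by convention, so
  -- pointwise convergence is only claimed off this null set.
  have hne : ∀ᵐ x : RSpace N ∂(volume.restrict Ω), x ≠ 0 :=
    ae_restrict_of_ae (Measure.ae_ne volume 0)
  have hlim : ∀ x : RSpace N, x ≠ 0 →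
      Tendsto (fun n : ℕ => (‖x‖ ^ 2 + 1 / ((n : ℝ) + 1))⁻¹) atTop (𝓝 (‖x‖ ^ 2)⁻¹) := by
    intro x hx
    refine Tendsto.inv₀ ?_ (by positivity)
    simpa using tendsto_one_div_add_atTop_nhds_zero_nat.const_add (‖x‖ ^ 2)
  have hreg := fun n : ℕ => regularized_rellich hN hΩ.isOpen hΩ.isBounded hu2 hu0
    (ε := 1 / ((n : ℝ) + 1)) (by positivity)
  obtain ⟨hI, hle⟩ := integrable_of_tendsto_of_integral_le
    (f := fun x => ((N : ℝ) - 4) ^ 2 * (u x * (‖x‖ ^ 2)⁻¹) ^ 2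
      + 2 * ((N : ℝ) - 4) * (‖weakGrad Ω u x‖ ^ 2 * (‖x‖ ^ 2)⁻¹))
    (fun n => (hreg n).1) (fun n x => by positivity) (fun n => (hreg n).2) (by
      filter_upwards [hne] with x hx
      exact ((((hlim x hx).const_mul (u x)).pow 2).const_mul _).add
        (((hlim x hx).const_mul _).const_mul _))
  have hmeas : Measurable fun x : RSpace N => ‖x‖ := measurable_norm
  have hm1 : AEStronglyMeasurable (fun x => u x / ‖x‖ ^ 2) (volume.restrict Ω) :=
    (hu1.1.1.aemeasurable.div (hmeas.pow_const 2).aemeasurable).aestronglyMeasurable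
  have hm2 : AEStronglyMeasurable (fun x => ‖x‖⁻¹ • weakGrad Ω u x) (volume.restrict Ω) :=
    hmeas.inv.aestronglyMeasurable.smul hgrad.1
  have e1 : ∀ x, ‖u x / ‖x‖ ^ 2‖ ^ 2 = (u x * (‖x‖ ^ 2)⁻¹) ^ 2 := fun x => by
    rw [Real.norm_eq_abs, sq_abs, div_eq_mul_inv]
  have e2 : ∀ x, ‖‖x‖⁻¹ • weakGrad Ω u x‖ ^ 2 = ‖weakGrad Ω u x‖ ^ 2 * (‖x‖ ^ 2)⁻¹ := fun x => by
    rw [norm_smul, norm_inv, norm_norm, mul_pow, inv_pow, mul_comm]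
  -- Fatou controls only the sum; as both summands are nonnegative with positive coefficients, each
  -- is dominated by a multiple of it.
  have I1 : Integrable (fun x => (u x * (‖x‖ ^ 2)⁻¹) ^ 2) (volume.restrict Ω) := by
    refine (hI.const_mul ((((N : ℝ) - 4) ^ 2)⁻¹)).mono' ?_ (Eventually.of_forall fun x => ?_)
    · simpa only [div_eq_mul_inv] using hm1.fun_pow 2
    · rw [Real.norm_of_nonneg (by positivity), mul_add, inv_mul_cancel_left₀ (by positivity)]
      exact le_add_of_nonneg_right (by positivity)
  have I2 : Integrable (fun x => ‖weakGrad Ω u x‖ ^ 2 * (‖x‖ ^ 2)⁻¹) (volume.restrict Ω) := by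
    refine (hI.const_mul ((2 * ((N : ℝ) - 4))⁻¹)).mono' ?_ (Eventually.of_forall fun x => ?_)
    · simpa only [e2] using hm2.norm.fun_pow 2
    · rw [Real.norm_of_nonneg (by positivity), mul_add, inv_mul_cancel_left₀ (by positivity)]
      exact le_add_of_nonneg_left (by positivity)
  refine ⟨?_, ?_, ?_⟩
  · rw [memLp_two_iff_integrable_sq_norm hm1]
    simpa only [e1] using I1
  · rw [memLp_two_iff_integrable_sq_norm hm2]
    simpa only [e2] using I2
  · rw [integral_add (I1.const_mul _) (I2.const_mul _), integral_const_mul,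
      integral_const_mul] at hle
    have e3 : ∀ x, |u x| ^ 2 / ‖x‖ ^ 4 = (u x * (‖x‖ ^ 2)⁻¹) ^ 2 := fun x => by
      rw [sq_abs, mul_pow, inv_pow, ← pow_mul, div_eq_mul_inv]
    simp only [e3]
    simpa only [div_eq_mul_inv] using hle
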